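/- **Setting.** Let $X$ be a Hausdorff topological space and $k\ge 1$. An IFS on $X$ is a tuple $\mathcal S=(f_i)_{i=1}^k$ of continuous maps $f_i:X\to X$; write $\mathcal S(K)=\bigcup_i f_i(K)$ for $K$ in the family $\mathcal K(X)$ of nonempty compact subsets of $X$ (with the Vietoris topology). $\mathcal S$ is *compactly dominating* if every $K\in\mathcal K(X)$ is contained in some $D\in\mathcal K(X)$ with $\mathcal S(D)\subset D$; it is *topologically contracting* if moreover for each such subinvariant $D$ and each sequence $(\sigma_n)$ in $\{1,\dots,k\}$ the set $\bigcap_{n\ge1}f_{\sigma_1}\circ\dots\circ f_{\sigma_n}(D)$ is a singleton. The *attractor* $A_{\mathcal S}\in\mathcal K(X)$ of $\mathcal S$ is the set with $\mathcal S(A_{\mathcal S})=A_{\mathcal S}$ and $\mathcal S^{(n)}(K)\to A_{\mathcal S}$ for all $K\in\mathcal K(X)$. Let $\mathcal K_{\mathcal F}(X)$ be the set of compact fuzzy sets: upper semicontinuous $u:X\to[0,1]$ attaining the value $1$ with compact support $[u]^0=\overline{\{u>0\}}$; put $[u]^\alpha=\{u\ge\alpha\}$ for $0<\alpha\le1$.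 A fuzzy IFS $\mathcal S_{\mathcal F}=(\mathcal S,(\varrho_i)_{i=1}^k)$ consists of an IFS and nondecreasing right-continuous maps $\varrho_i:[0,1]\to[0,1]$ with $\varrho_i(0)=0$ for all $i$ and $\varrho_j(1)=1$ for some $j$. It acts on $\mathcal K_{\mathcal F}(X)$ by $\mathcal S_{\mathcal F}(u)=\max_i\varrho_i\circ f_i[u]$, where $f[u](y)=\sup\{u(x):f(x)=y\}$ (and $\sup\emptyset=0$). The *$h$-topology* on $\mathcal K_{\mathcal F}(X)$ is induced from the Vietoris topology on $\mathcal K(X\times[0,1])$ by $u\mapsto\{(x,\alpha):x\in[u]^0,\ 0\le\alpha\le u(x)\}$. A multimetric is a family of pseudometrics separating points; it is admissible on $X$ if it generates the topology of $X$, and directed if any finitely many of its members are dominated by a single member. For an admissible multimetric $\mathcal D$ on $X$, the *canonical topology* on $\mathcal K_{\mathcal F}(X)$ is generated by the pseudometrics $d_{HF}(u,v)=\sup_{\alpha\in[0,1]}d_H([u]^\alpha,[v]^\alpha)$, where $d_H$ is the Hausdorff distance for $d$ and $d$ runs over a directed admissible multimetric. It does not depend on the choice of the multimetric; on a Tychonoff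 space it is called the *$M$-topology*. A $u\in\mathcal K_{\mathcal F}(X)$ with $\mathcal S_{\mathcal F}(u)=u$ and $\mathcal S_{\mathcal F}^{(n)}(v)\to u$ for all $v\in\mathcal K_{\mathcal F}(X)$ is called a *weak fuzzy attractor* if the convergence is in the $h$-topology, and a *fuzzy attractor* (for $X$ Tychonoff, or for a multimetric space) if it is in the $M$-topology (the canonical topology). **Proposition.** Let $\mathcal S_{\mathcal F}=(\mathcal S,\varrho)$ be a fuzzy IFS on a Hausdorff space $X$ such that $\mathcal S$ is topologically contracting, and let $u_{\mathcal S}$ be its weak fuzzy attractor. Then: (i) $\mathcal S$ has a unique attractor $A_{\mathcal S}$, the restricted fuzzy IFS $((f_i{\restriction}_{A_{\mathcal S}})_{i=1}^k,\varrho)$ on $A_{\mathcal S}$ has a unique fuzzy attractor $u_{\hat{\mathcal S}}$, and $u_{\mathcal S}$ is its extension by zero: $u_{\mathcal S}(x)=u_{\hat{\mathcal S}}(x)$ for $x\in A_{\mathcal S}$ and $u_{\mathcal S}(x)=0$ for $x\notin A_{\mathcal S}$. (ii) For every nonempty compact $K\subset X$ with $\mathcal S(K)\subset K$, the restriction $u_{\mathcal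 S}{\restriction}_K$ is a compact fuzzy set on $K$ and is a fuzzy attractor of the restricted fuzzy IFS $((f_i{\restriction}_K)_{i=1}^k,\varrho)$ on $K$. In particular, (i) and (ii) hold for a fuzzy attractor $u_{\mathcal S}$ of a fuzzy IFS on a multimetric space $(X,\mathcal D)$ (with the topology generated by $\mathcal D$) whose IFS $\mathcal S$ is compactly dominating and Edelstein contracting, that is, for all $d\in\mathcal D$, $i$ and $x,y\in X$: $d(f_i(x),f_i(y))\le d(x,y)$, with strict inequality if $d(x,y)>0$. -/

import Mathlib

open Set Filter Topology TopologicalSpace unitInterval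
open scoped ENNReal

/-! ### Iterated function systems on Hausdorff spaces -/

/-- An iterated function system: a `k`-tuple of continuous selfmaps (with `k ≥ 1` wherever it
matters). -/
abbrev IFS (X : Type*) [TopologicalSpace X] (k : ℕ) := Fin k → C(X, X)

namespace IFS

/-- The Hutchinson operator `S(K) = ⋃ i, f_i(K)` on nonempty compact sets. The type
`NonemptyCompacts X` carries the Vietoris topology. -/
def hutchinson {X : Type*} [TopologicalSpace X] {k : ℕ} [NeZero k] (S : IFS X k)
    (K : NonemptyCompacts X) : NonemptyCompacts X where
  carrier := ⋃ i, S i '' (K : Set X)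
  isCompact' := isCompact_iUnion fun i => K.isCompact.image (S i).continuous
  nonempty' := by
    obtain ⟨x, hx⟩ := K.nonempty
    exact ⟨S 0 x, mem_iUnion.2 ⟨0, x, hx, rfl⟩⟩

/-- `A` is the attractor of `S`: it is invariant and all iterations converge to it in the Vietoris
topology. -/
structure IsAttractor {X : Type*} [TopologicalSpace X] {k : ℕ} [NeZero k] (S : IFS X k)
    (A : NonemptyCompacts X) : Prop where
  invariant : S.hutchinson A = A
  tendsto : ∀ K : NonemptyCompacts X, Tendsto (fun n : ℕ => S.hutchinson^[n] K) atTop (𝓝 A)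

/-- Every nonempty compact set is contained in a subinvariant nonempty compact set. -/
def CompactlyDominating {X : Type*} [TopologicalSpace X] {k : ℕ} [NeZero k] (S : IFS X k) : Prop :=
  ∀ K : NonemptyCompacts X, ∃ D : NonemptyCompacts X, K ≤ D ∧ S.hutchinson D ≤ D

/-- The composition `f_{w 0} ∘ f_{w 1} ∘ ... ∘ f_{w (n - 1)}`. -/
def comp {X : Type*} [TopologicalSpace X] {k : ℕ} (S : IFS X k) (w : ℕ → Fin k) : ℕ → X → X
  | 0 => id
  | n + 1 => S.comp w n ∘ S (w n)

/-- Topological contractivity: compact dominancy, and all the fibres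
`⋂ n ≥ 1, f_{w_1} ∘ ... ∘ f_{w_n} (D)` of subinvariant compact sets `D` are singletons. -/
def TopologicallyContracting {X : Type*} [TopologicalSpace X] {k : ℕ} [NeZero k] (S : IFS X k) :
    Prop :=
  S.CompactlyDominating ∧
    ∀ D : NonemptyCompacts X, S.hutchinson D ≤ D → ∀ w : ℕ → Fin k,
      ∃ x : X, ⋂ n : ℕ, S.comp w (n + 1) '' (D : Set X) = {x}

theorem mapsTo_of_le {X : Type*} [TopologicalSpace X] {k : ℕ} [NeZero k] {S : IFS X k}
    {K : NonemptyCompacts X} (hK : S.hutchinson K ≤ K) (i : Fin k) :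
    MapsTo (S i) (K : Set X) (K : Set X) :=
  fun x hx => hK (mem_iUnion.2 ⟨i, x, hx, rfl⟩ : S i x ∈ ⋃ i, S i '' (K : Set X))

/-- The restriction of `S` to a subinvariant nonempty compact set `K`. -/
def restrict {X : Type*} [TopologicalSpace X] {k : ℕ} [NeZero k] (S : IFS X k)
    (K : NonemptyCompacts X) (hK : S.hutchinson K ≤ K) : IFS K k :=
  fun i => ⟨(mapsTo_of_le hK i).restrict (S i) K K,
    (S i).continuous.restrict (mapsTo_of_le hK i)⟩

end IFS

/-! ### Multimetrics -/

/-- The topology generated by a family of distance functions: `U` is open if with each point `x` it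
contains some finite intersection of balls `{y | ∀ d ∈ G, d x y < ε}` with `ε > 0`. -/
@[reducible]
def distTopology {Y R : Type*} [LinearOrder R] [Zero R] [One R] [ZeroLEOneClass R]
    [NeZero (1 : R)] (D : Set (Y → Y → R)) :
    TopologicalSpace Y where
  IsOpen U := ∀ x ∈ U, ∃ ε : R, 0 < ε ∧ ∃ G : Finset (Y → Y → R), ↑G ⊆ D ∧
    {y | ∀ d ∈ G, d x y < ε} ⊆ U
  isOpen_univ := fun _ _ => by
    exact ⟨1, zero_lt_one, ∅, by simp, subset_univ _⟩
  isOpen_inter := by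
    classical
    rintro U V hU hV x ⟨hxU, hxV⟩
    obtain ⟨e, he, G, hG, h⟩ := hU x hxU
    obtain ⟨e', he', G', hG', h'⟩ := hV x hxV
    refine ⟨min e e', lt_min he he', G ∪ G', by simp [hG, hG'], fun y hy => ⟨h ?_, h' ?_⟩⟩
    · exact fun d hd => (hy d (Finset.mem_union_left _ hd)).trans_le (min_le_left _ _)
    · exact fun d hd => (hy d (Finset.mem_union_right _ hd)).trans_le (min_le_right _ _)
  isOpen_sUnion := by
    rintro s hs x ⟨U, hU, hx⟩
    obtain ⟨e, he, G, hG, h⟩ := hs U hU x hx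
    exact ⟨e, he, G, hG, h.trans (subset_sUnion_of_mem hU)⟩

/-- `D` is an admissible multimetric on the topological space `X`: it separates points and the
topology generated by `D` is the topology of `X`. -/
structure IsAdmissibleMultimetric {X : Type*} [t : TopologicalSpace X]
    (D : Set (PseudoMetric X ℝ)) : Prop where
  separates : ∀ x y : X, x ≠ y → ∃ d ∈ D, 0 < d x y
  generates : t = distTopology ((fun d : PseudoMetric X ℝ => (d : X → X → ℝ)) '' D)

/-- The directed multimetric of all maxima of nonempty finite subfamilies of `D`; it generates the
same topology as `D`. -/
def directedHull {X : Type*} (D : Set (PseudoMetric X ℝ)) : Set (PseudoMetric X ℝ) :=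
  {d | ∃ (G : Finset (PseudoMetric X ℝ)) (hG : G.Nonempty), ↑G ⊆ D ∧ d = G.sup' hG id}

/-- The family of all continuous pseudometrics. On a Tychonoff space it is an admissible directed
multimetric, see `continuousPseudoMetrics_admissible`. -/
def continuousPseudoMetrics (X : Type*) [TopologicalSpace X] : Set (PseudoMetric X ℝ) :=
  {d | Continuous fun p : X × X => d p.1 p.2}

theorem continuousPseudoMetrics_directed (X : Type*) [TopologicalSpace X] :
    directedHull (continuousPseudoMetrics X) = continuousPseudoMetrics X := by
  ext d
  constructor
  · rintro ⟨G, hG, hGD, rfl⟩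
    refine Finset.sup'_induction hG id (p := (· ∈ continuousPseudoMetrics X)) ?_
      fun d hd => hGD hd
    intro a ha b hb
    have ha' : Continuous fun p : X × X => a p.1 p.2 := ha
    have hb' : Continuous fun p : X × X => b p.1 p.2 := hb
    exact ha'.max hb'
  · intro hd
    exact ⟨{d}, Finset.singleton_nonempty d, by simpa using hd, by simp⟩

theorem continuousPseudoMetrics_admissible (X : Type*) [TopologicalSpace X] [T35Space X] :
    IsAdmissibleMultimetric (continuousPseudoMetrics X) := by
  have key : ∀ (x : X) (K : Set X), IsClosed K → x ∉ K →
      ∃ d ∈ continuousPseudoMetrics X, ∀ y ∈ K, d x y = 1 := by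
    intro x K hK hx
    obtain ⟨f, hf, hfx, hfK⟩ := CompletelyRegularSpace.completely_regular x K hK hx
    refine ⟨⟨fun a b => |(f a : ℝ) - f b|, fun a => by simp, fun a b => abs_sub_comm _ _,
      fun a b c => abs_sub_le _ _ _⟩, ?_, fun y hy => ?_⟩
    · change Continuous fun p : X × X => |(f p.1 : ℝ) - f p.2|
      fun_prop
    · change |(f x : ℝ) - f y| = 1
      simp [hfx, hfK hy]
  refine ⟨fun x y hxy => ?_, ?_⟩
  · obtain ⟨d, hd, h⟩ := key x {y} isClosed_singleton (by simpa using hxy)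
    exact ⟨d, hd, by simp [h y rfl]⟩
  · refine TopologicalSpace.ext_iff.2 fun U => ⟨fun hU x hx => ?_, fun hU => ?_⟩
    · obtain ⟨d, hd, h⟩ := key x Uᶜ hU.isClosed_compl (by simpa using hx)
      refine ⟨1, one_pos, {(d : X → X → ℝ)}, ?_, fun y hy => ?_⟩
      · rw [Finset.coe_singleton, singleton_subset_iff]
        exact ⟨d, hd, rfl⟩
      by_contra hyU
      have := hy d (by simp)
      rw [h y hyU] at this
      exact lt_irrefl _ this
    · refine isOpen_iff_mem_nhds.2 fun x hx => ?_
      obtain ⟨e, he, G, hG, h⟩ := hU x hx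
      refine mem_of_superset ?_ h
      refine (Filter.eventually_all_finset G).2 fun d hd => ?_
      obtain ⟨d, hd', rfl⟩ := hG hd
      have hd'' : Continuous fun p : X × X => d p.1 p.2 := hd'
      have hc : Continuous fun y => d x y :=
        hd''.comp (continuous_const.prodMk continuous_id : Continuous fun y : X => (x, y))
      exact hc.continuousAt.eventually_lt continuousAt_const (by simpa using he)

/-- Edelstein contractivity with respect to a multimetric: every map of the system is an Edelstein
contraction with respect to every pseudometric of the family. -/
def IFS.EdelsteinContracting {X : Type*} [TopologicalSpace X] {k : ℕ} (S : IFS X k)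
    (D : Set (PseudoMetric X ℝ)) : Prop :=
  ∀ d ∈ D, ∀ i, (∀ x y, d (S i x) (S i y) ≤ d x y) ∧
    ∀ x y, 0 < d x y → d (S i x) (S i y) < d x y

/-! ### Compact fuzzy sets -/

/-- The cuts of a fuzzy set: `{x | α ≤ u x}` for `α > 0`, and the support (the closure of
`{x | 0 < u x}`) for `α = 0`. -/
def fuzzyCut {X : Type*} [TopologicalSpace X] (u : X → I) (α : I) : Set X :=
  if α = 0 then closure {x | 0 < u x} else {x | α ≤ u x}

/-- The compact fuzzy sets: normal, upper semicontinuous and compactly supported fuzzy sets. -/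
structure CompactFuzzySet (X : Type*) [TopologicalSpace X] where
  toFun : X → I
  normal' : ∃ x, toFun x = 1
  usc' : UpperSemicontinuous toFun
  isCompact_support' : IsCompact (fuzzyCut toFun 0)

namespace CompactFuzzySet

instance {X : Type*} [TopologicalSpace X] : CoeFun (CompactFuzzySet X) fun _ => X → I := ⟨toFun⟩

/-- The hypograph `{(x, α) | x ∈ [u]^0, 0 ≤ α ≤ u x}`, a nonempty compact subset of `X × [0,1]`. -/
def hypo {X : Type*} [TopologicalSpace X] (u : CompactFuzzySet X) : NonemptyCompacts (X × I) where
  carrier := {p | p.1 ∈ fuzzyCut u 0 ∧ p.2 ≤ u p.1}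
  isCompact' := by
    have h : IsClosed {p : X × I | p.2 ≤ u p.1} := u.usc'.IsClosed_hypograph
    refine ((u.isCompact_support'.prod (isCompact_univ (X := I))).inter_right h).of_isClosed_subset
      ?_ ?_
    · refine IsClosed.inter (s₁ := Prod.fst ⁻¹' fuzzyCut u 0) ?_ h
      refine IsClosed.preimage continuous_fst ?_
      simp [fuzzyCut]
    · exact fun p hp => ⟨⟨hp.1, trivial⟩, hp.2⟩
  nonempty' := by
    obtain ⟨x, hx⟩ := u.normal'
    refine ⟨(x, 0), ?_, unitInterval.nonneg'⟩
    rw [fuzzyCut, if_pos rfl]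
    exact subset_closure (by simp [hx])

/-- The `h`-topology: induced from the Vietoris topology on `NonemptyCompacts (X × I)` by identifying
a compact fuzzy set with its hypograph. -/
@[reducible]
def hTopology (X : Type*) [TopologicalSpace X] : TopologicalSpace (CompactFuzzySet X) :=
  TopologicalSpace.induced hypo inferInstance

end CompactFuzzySet

/-- The Hausdorff(-Pompeiu) distance of two sets with respect to a pseudometric `d`. It is taken with
values in `[0,∞]`; it is finite for nonempty compact sets and continuous `d`. -/
noncomputable def hausdorffDistWrt {X : Type*} (d : PseudoMetric X ℝ) (K L : Set X) : ℝ≥0∞ :=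
  max (⨆ x ∈ K, ⨅ y ∈ L, ENNReal.ofReal (d x y)) (⨆ y ∈ L, ⨅ x ∈ K, ENNReal.ofReal (d x y))

/-- The fuzzy Hausdorff distance `d_HF(u, v) = sup_α d_H([u]^α, [v]^α)`. -/
noncomputable def fuzzyHausdorffDist {X : Type*} [TopologicalSpace X] (d : PseudoMetric X ℝ)
    (u v : CompactFuzzySet X) : ℝ≥0∞ :=
  ⨆ α : I, hausdorffDistWrt d (fuzzyCut u α) (fuzzyCut v α)

/-- The canonical topology on compact fuzzy sets induced by a multimetric `D`: the topology generated
by all `d_HF`, where `d` runs through a directed multimetric topologically equivalent to `D`. -/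
@[reducible]
noncomputable def canonicalTopology {X : Type*} [TopologicalSpace X] (D : Set (PseudoMetric X ℝ)) :
    TopologicalSpace (CompactFuzzySet X) :=
  distTopology (fuzzyHausdorffDist '' directedHull D)

/-- The `M`-topology on the compact fuzzy sets of a Tychonoff space: the canonical topology induced
by an admissible multimetric, here by the family of all continuous pseudometrics. (The canonical
topology is the same for all admissible multimetrics.) -/
@[reducible]
noncomputable def mTopology (X : Type*) [TopologicalSpace X] :
    TopologicalSpace (CompactFuzzySet X) :=
  canonicalTopology (continuousPseudoMetrics X)

/-! ### Fuzzy iterated function systems -/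

/-- The image `f[u]` of a fuzzy set: `f[u](y)` is the supremum of `u` over the fibre `f⁻¹(y)`, which
is `0` for an empty fibre because the supremum is taken in `[0,1]`. -/
noncomputable def fuzzyImage {X Y : Type*} (f : X → Y) (u : X → I) (y : Y) : I :=
  ⨆ x ∈ f ⁻¹' {y}, u x

/-- An admissible system of grey level maps. -/
structure GreyLevelSystem (k : ℕ) where
  toFun : Fin k → I → I
  monotone' : ∀ i, Monotone (toFun i)
  rightContinuous' : ∀ i t, ContinuousWithinAt (toFun i) (Ioi t) t
  map_zero' : ∀ i, toFun i 0 = 0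
  exists_map_one' : ∃ i, toFun i 1 = 1

instance {k : ℕ} : CoeFun (GreyLevelSystem k) fun _ => Fin k → I → I := ⟨GreyLevelSystem.toFun⟩

theorem GreyLevelSystem.usc_comp {X : Type*} [TopologicalSpace X] {k : ℕ} (ρ : GreyLevelSystem k)
    (i : Fin k) {u : X → I} (hu : UpperSemicontinuous u) :
    UpperSemicontinuous fun x => ρ i (u x) := by
  intro x a ha
  have h1 : ∀ᶠ t in 𝓝[>] (u x), ρ i t < a :=
    (ρ.rightContinuous' i (u x)).eventually (gt_mem_nhds ha)
  by_cases hx : u x = 1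
  · exact Eventually.of_forall fun y =>
      (ρ.monotone' i (hx ▸ unitInterval.le_one' : u y ≤ u x)).trans_lt ha
  · have hlt : u x < 1 := lt_of_le_of_ne unitInterval.le_one' hx
    have : (𝓝[>] (u x)).NeBot := nhdsGT_neBot_of_exists_gt ⟨1, hlt⟩
    obtain ⟨t, ht, hxt⟩ := (h1.and self_mem_nhdsWithin).exists
    exact (hu x t hxt).mono fun y hy => (ρ.monotone' i hy.le).trans_lt ht

theorem exists_eq_fuzzyImage {X : Type*} [TopologicalSpace X] [T2Space X] (f : C(X, X))
    (u : CompactFuzzySet X) (y : X) (h : fuzzyImage f u y ≠ 0) :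
    ∃ x, f x = y ∧ u x = fuzzyImage f u y := by
  have hpos : (0 : I) < fuzzyImage f u y := lt_of_le_of_ne unitInterval.nonneg' (Ne.symm h)
  have hsub : ∀ x, 0 < u x → x ∈ fuzzyCut u 0 := fun x hx => by
    rw [fuzzyCut, if_pos rfl]
    exact subset_closure hx
  have hne : (fuzzyCut u 0 ∩ f ⁻¹' {y}).Nonempty := by
    obtain ⟨x, hx⟩ := lt_iSup_iff.1 hpos
    obtain ⟨hxy, hx⟩ := lt_iSup_iff.1 hx
    exact ⟨x, hsub x hx, hxy⟩
  have hcpt : IsCompact (fuzzyCut u 0 ∩ f ⁻¹' {y}) :=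
    u.isCompact_support'.inter_right (isClosed_singleton.preimage f.continuous)
  obtain ⟨x, hx, hmax⟩ := UpperSemicontinuousOn.exists_isMaxOn hne hcpt
    (u.usc'.upperSemicontinuousOn _)
  refine ⟨x, hx.2, le_antisymm (le_iSup₂_of_le x hx.2 le_rfl) (iSup₂_le fun z hz => ?_)⟩
  by_cases hz0 : 0 < u z
  · exact hmax ⟨hsub z hz0, hz⟩
  · exact (not_lt.1 hz0).trans unitInterval.nonneg'

/-- The fuzzy Hutchinson operator `u ↦ max_i ρ_i ∘ f_i[u]` on compact fuzzy sets. -/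
noncomputable def fuzzyHutchinson {X : Type*} [TopologicalSpace X] [T2Space X] {k : ℕ} [NeZero k]
    (S : IFS X k) (ρ : GreyLevelSystem k) (u : CompactFuzzySet X) : CompactFuzzySet X where
  toFun y := ⨆ i, ρ i (fuzzyImage (S i) u y)
  normal' := by
    obtain ⟨x, hx⟩ := u.normal'
    obtain ⟨j, hj⟩ := ρ.exists_map_one'
    refine ⟨S j x, le_antisymm unitInterval.le_one' (le_iSup_of_le j ?_)⟩
    have : fuzzyImage (S j) u (S j x) = 1 :=
      le_antisymm unitInterval.le_one' (hx ▸ le_iSup₂_of_le x rfl le_rfl)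
    rw [this, hj]
  usc' := by
    refine upperSemicontinuous_iff_isClosed_preimage.2 fun a => ?_
    rcases eq_or_lt_of_le (unitInterval.nonneg' : 0 ≤ a) with rfl | ha
    · convert isClosed_univ
      exact eq_univ_of_forall fun y => unitInterval.nonneg'
    have hset : (fun y => ⨆ i, ρ i (fuzzyImage (S i) u y)) ⁻¹' Ici a =
        ⋃ i, S i '' {x | a ≤ ρ i (u x)} := by
      ext y
      simp only [mem_preimage, mem_Ici, mem_iUnion, mem_image, mem_ofPred_eq]
      constructor
      · intro h
        obtain ⟨i, hi⟩ := exists_eq_ciSup_of_finite (f := fun i => ρ i (fuzzyImage (S i) u y))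
        rw [← hi] at h
        have h0 : fuzzyImage (S i) u y ≠ 0 := fun h0 => by
          simp only [h0, ρ.map_zero'] at h
          exact absurd h (not_le.2 ha)
        obtain ⟨x, hx, hux⟩ := exists_eq_fuzzyImage (S i) u y h0
        exact ⟨i, x, by rw [hux]; exact h, hx⟩
      · rintro ⟨i, x, hx, rfl⟩
        exact le_iSup_of_le i (hx.trans (ρ.monotone' i (le_iSup₂_of_le x rfl le_rfl)))
    rw [hset]
    refine isClosed_iUnion_of_finite fun i => ?_
    have hcl : IsClosed {x | a ≤ ρ i (u x)} := (ρ.usc_comp i u.usc').isClosed_preimage a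
    have hc : IsCompact {x | a ≤ ρ i (u x)} := by
      refine u.isCompact_support'.of_isClosed_subset hcl fun x hx => ?_
      rw [fuzzyCut, if_pos rfl]
      refine subset_closure (lt_of_le_of_ne unitInterval.nonneg' fun h0 => ?_)
      have hx' : a ≤ ρ i (u x) := hx
      rw [← h0, ρ.map_zero'] at hx'
      exact absurd hx' (not_le.2 ha)
    exact (hc.image (S i).continuous).isClosed
  isCompact_support' := by
    have hc : IsCompact (⋃ i, S i '' fuzzyCut u 0) :=
      isCompact_iUnion fun i => u.isCompact_support'.image (S i).continuous
    rw [fuzzyCut, if_pos rfl]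
    refine hc.of_isClosed_subset isClosed_closure (closure_minimal ?_ hc.isClosed)
    intro y hy
    have hy' : (0 : I) < ⨆ i, ρ i (fuzzyImage (S i) u y) := hy
    obtain ⟨i, hi⟩ := lt_iSup_iff.1 hy'
    have h0 : fuzzyImage (S i) u y ≠ 0 := fun h0 => by
      rw [h0, ρ.map_zero'] at hi
      exact lt_irrefl _ hi
    obtain ⟨x, hx, hux⟩ := exists_eq_fuzzyImage (S i) u y h0
    refine mem_iUnion.2 ⟨i, x, ?_, hx⟩
    rw [fuzzyCut, if_pos rfl]
    exact subset_closure (hux ▸ lt_of_le_of_ne unitInterval.nonneg' h0.symm : 0 < u x)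

/-- `u` is the fuzzy attractor of the fuzzy IFS `(S, ρ)` with respect to the topology `τ` on compact
fuzzy sets: it is invariant, and all iterations of the fuzzy Hutchinson operator converge to it. -/
structure IsFuzzyAttractorFor {X : Type*} [TopologicalSpace X] [T2Space X] {k : ℕ} [NeZero k]
    (τ : TopologicalSpace (CompactFuzzySet X)) (S : IFS X k) (ρ : GreyLevelSystem k)
    (u : CompactFuzzySet X) : Prop where
  invariant : u = fuzzyHutchinson S ρ u
  tendsto : ∀ v : CompactFuzzySet X,
    Tendsto (fun n : ℕ => (fuzzyHutchinson S ρ)^[n] v) atTop (@nhds _ τ u)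

/-- Fuzzy attractor on a multimetric space `(X, D)`. -/
def IsMultimetricFuzzyAttractor {X : Type*} [TopologicalSpace X] [T2Space X] {k : ℕ} [NeZero k]
    (D : Set (PseudoMetric X ℝ)) (S : IFS X k) (ρ : GreyLevelSystem k) (u : CompactFuzzySet X) :
    Prop :=
  IsFuzzyAttractorFor (canonicalTopology D) S ρ u

/-- Fuzzy attractor on a Tychonoff space (with respect to the `M`-topology). -/
def IsFuzzyAttractor {X : Type*} [TopologicalSpace X] [T35Space X] {k : ℕ} [NeZero k]
    (S : IFS X k) (ρ : GreyLevelSystem k) (u : CompactFuzzySet X) : Prop :=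
  IsFuzzyAttractorFor (mTopology X) S ρ u

/-- Weak fuzzy attractor on a Hausdorff space (with respect to the `h`-topology). -/
def IsWeakFuzzyAttractor {X : Type*} [TopologicalSpace X] [T2Space X] {k : ℕ} [NeZero k]
    (S : IFS X k) (ρ : GreyLevelSystem k) (u : CompactFuzzySet X) : Prop :=
  IsFuzzyAttractorFor (CompactFuzzySet.hTopology X) S ρ u

open Classical in
/-- The canonical extension `e(u)` by zero of a fuzzy set `u` on a subset `Y` of `X`. -/
noncomputable def zeroExtension {X : Type*} {Y : Set X} (u : Y → I) (x : X) : I :=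
  if h : x ∈ Y then u ⟨x, h⟩ else 0

/-! Two facts carry the proof. First, cylinders shrink uniformly (`eventually_comp_mem`): the
address space is compact, so the pairs of points in a common cylinder of order `n`, recorded with
the address, form decreasing compact sets. Singleton fibres put their intersection on the diagonal,
so they eventually lie over any given open neighbourhood of it. This also yields the crisp
attractor.

Second, positive grey values transfer between fuzzy sets (`exists_comp_of_le_iterate`). A positive
value of an iterate is produced along one chain of maps and grey level maps. By monotonicity,
starting the same chain where another fuzzy set equals `1` gives at least that value, at a point of
the same cylinder. On a compact space, the iterates of any two fuzzy sets therefore approach each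
other in every `d_HF`, so an invariant fuzzy set is the fuzzy attractor.

An invariant `u` vanishes off each subinvariant compact `K` (`eq_zero_of_notMem`), hence its
restriction to `K` stays invariant and is the fuzzy attractor there. Edelstein systems reduce to the
topological case by maximizing a distance over pairs in a common fibre. -/

namespace IFS

/-! ### Cylinder sets and their uniform shrinking. -/

variable {X : Type*} [TopologicalSpace X] {k : ℕ}

/-- `comp` grows at the inner end, whereas iterating a Hutchinson operator adds a map at the outer
end; this bridges the two recursions. -/
theorem comp_succ' (S : IFS X k) (w : ℕ → Fin k) (n : ℕ) :
    S.comp w (n + 1) = S (w 0) ∘ S.comp (fun m => w (m + 1)) n := by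
  induction n with
  | zero => rfl
  | succ n ih =>
    change S.comp w (n + 1) ∘ S (w (n + 1)) = _
    rw [ih]
    rfl

theorem comp_mapsTo {S : IFS X k} {D : Set X} (h : ∀ i, MapsTo (S i) D D) (w : ℕ → Fin k) :
    ∀ n, MapsTo (S.comp w n) D D
  | 0 => mapsTo_id D
  | n + 1 => (comp_mapsTo h w n).comp (h (w n))

theorem comp_succ_image_subset {S : IFS X k} {D : Set X} (h : ∀ i, MapsTo (S i) D D)
    (w : ℕ → Fin k) (n : ℕ) : S.comp w (n + 1) '' D ⊆ S.comp w n '' D := by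
  rintro _ ⟨x, hx, rfl⟩
  exact ⟨S (w n) x, h _ hx, rfl⟩

theorem comp_image_antitone {S : IFS X k} {D : Set X} (h : ∀ i, MapsTo (S i) D D)
    (w : ℕ → Fin k) : Antitone fun n => S.comp w n '' D :=
  antitone_nat_of_succ_le (comp_succ_image_subset h w)

theorem iInter_comp_succ_image {S : IFS X k} {D : Set X} (h : ∀ i, MapsTo (S i) D D)
    (w : ℕ → Fin k) : ⋂ n, S.comp w (n + 1) '' D = ⋂ n, S.comp w n '' D :=
  (comp_image_antitone h w).iInter_nat_add 1

/-- Continuity in the address as well is what makes the cylinder pairs compact; it holds because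
only finitely many letters of a discrete alphabet matter. -/
theorem continuous_comp_uncurry (S : IFS X k) (n : ℕ) :
    Continuous fun p : (ℕ → Fin k) × X => S.comp p.1 n p.2 := by
  induction n with
  | zero => exact continuous_snd
  | succ n ih =>
    have h : Continuous fun p : Fin k × X => S p.1 p.2 :=
      continuous_prod_of_discrete_left.2 fun i => (S i).continuous
    have h' : Continuous fun p : (ℕ → Fin k) × X => S (p.1 n) p.2 :=
      h.comp (((continuous_apply n).comp continuous_fst).prodMk continuous_snd :
        Continuous fun p : (ℕ → Fin k) × X => (p.1 n, p.2))
    exact ih.comp (continuous_fst.prodMk h')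

theorem continuous_comp (S : IFS X k) (w : ℕ → Fin k) (n : ℕ) : Continuous (S.comp w n) :=
  (S.continuous_comp_uncurry n).comp (continuous_const.prodMk continuous_id)

/-- The pairs of points in the `n`-th cylinder sets, together with the addresses. -/
def cylinderPairs (S : IFS X k) (D : Set X) (n : ℕ) : Set ((ℕ → Fin k) × X × X) :=
  {p | p.2.1 ∈ S.comp p.1 n '' D ∧ p.2.2 ∈ S.comp p.1 n '' D}

theorem isCompact_cylinderPairs (S : IFS X k) {D : Set X} (hD : IsCompact D) (n : ℕ) :
    IsCompact (S.cylinderPairs D n) := by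
  have h1 := (isCompact_univ (X := ℕ → Fin k)).prod (hD.prod hD)
  have hc : Continuous fun p : (ℕ → Fin k) × X × X =>
      (p.1, S.comp p.1 n p.2.1, S.comp p.1 n p.2.2) :=
    continuous_fst.prodMk
      (((S.continuous_comp_uncurry n).comp
          (continuous_fst.prodMk (continuous_fst.comp continuous_snd))).prodMk
        ((S.continuous_comp_uncurry n).comp
          (continuous_fst.prodMk (continuous_snd.comp continuous_snd))))
  convert h1.image hc using 1
  ext ⟨w, x, y⟩
  constructor
  · rintro ⟨⟨a, ha, hx⟩, b, hb, hy⟩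
    exact ⟨(w, a, b), ⟨trivial, ha, hb⟩, Prod.ext rfl (Prod.ext hx hy)⟩
  · rintro ⟨⟨w', a, b⟩, ⟨-, ha, hb⟩, h⟩
    obtain ⟨h1, h2⟩ := Prod.mk.inj h
    obtain ⟨h3, h4⟩ := Prod.mk.inj h2
    have h1 : w' = w := h1
    subst h1
    exact ⟨⟨a, ha, h3⟩, b, hb, h4⟩

theorem cylinderPairs_succ_subset {S : IFS X k} {D : Set X} (h : ∀ i, MapsTo (S i) D D) (n : ℕ) :
    S.cylinderPairs D (n + 1) ⊆ S.cylinderPairs D n :=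
  fun p hp => ⟨comp_succ_image_subset h p.1 n hp.1, comp_succ_image_subset h p.1 n hp.2⟩

/-- Singleton fibres force the cylinder sets to shrink uniformly in the address. -/
theorem eventually_comp_mem [T2Space X] {S : IFS X k} {D : Set X} (hD : IsCompact D)
    (hmap : ∀ i, MapsTo (S i) D D)
    (hfib : ∀ w, (⋂ n : ℕ, S.comp w (n + 1) '' D).Subsingleton)
    {W : Set (X × X)} (hW : IsOpen W) (hdiag : ∀ x, (x, x) ∈ W) :
    ∃ N, ∀ n ≥ N, ∀ w, ∀ a ∈ D, ∀ b ∈ D, (S.comp w n a, S.comp w n b) ∈ W := by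
  set E : ℕ → Set ((ℕ → Fin k) × X × X) := fun n => S.cylinderPairs D n ∩ Prod.snd ⁻¹' Wᶜ
  have hcl : IsClosed (Prod.snd ⁻¹' Wᶜ : Set ((ℕ → Fin k) × X × X)) :=
    hW.isClosed_compl.preimage continuous_snd
  have hEc : ∀ n, IsCompact (E n) := fun n => (S.isCompact_cylinderPairs hD n).inter_right hcl
  have hEs : ∀ n, E (n + 1) ⊆ E n := fun n =>
    inter_subset_inter_left _ (cylinderPairs_succ_subset hmap n)
  have hEa : Antitone E := antitone_nat_of_succ_le hEs
  by_cases hne : ∀ n, (E n).Nonempty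
  · obtain ⟨⟨w, x, y⟩, hp⟩ := IsCompact.nonempty_iInter_of_sequence_nonempty_isCompact_isClosed E
      hEs hne (hEc 0) fun n => (hEc n).isClosed
    rw [mem_iInter] at hp
    -- The fibres start at order one, hence the shift of the index.
    have hxy : x = y := hfib w (mem_iInter.2 fun n => (hp (n + 1)).1.1)
      (mem_iInter.2 fun n => (hp (n + 1)).1.2)
    subst hxy
    exact absurd (hdiag x) (hp 0).2
  · push Not at hne
    obtain ⟨N, hN⟩ := hne
    refine ⟨N, fun n hn w a ha b hb => by_contra fun hab => ?_⟩
    have : ((w, S.comp w n a, S.comp w n b) : (ℕ → Fin k) × X × X) ∈ E n :=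
      ⟨⟨⟨a, ha, rfl⟩, b, hb, rfl⟩, hab⟩
    have h' := hEa hn this
    rw [hN] at h'
    exact h'

/-- If a point of an open set lies in a cylinder of large order, then the whole cylinder lies in
that open set. -/
theorem eventually_comp_mem_of_mem [T2Space X] {S : IFS X k} {D : Set X} (hD : IsCompact D)
    (hmap : ∀ i, MapsTo (S i) D D)
    (hfib : ∀ w, (⋂ n : ℕ, S.comp w (n + 1) '' D).Subsingleton)
    {U : Set X} (hU : IsOpen U) {x : X} (hx : x ∈ U) :
    ∃ N, ∀ n ≥ N, ∀ w, ∀ a ∈ D, S.comp w n a = x → ∀ b ∈ D, S.comp w n b ∈ U := by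
  -- This `W` contains the diagonal, and a pair in it with first entry `x` has its second entry in
  -- `U`.
  obtain ⟨N, hN⟩ := eventually_comp_mem hD hmap hfib
    (W := U ×ˢ U ∪ {x}ᶜ ×ˢ univ)
    ((hU.prod hU).union (isClosed_singleton.isOpen_compl.prod isOpen_univ)) fun y => by
      by_cases hy : y = x
      · exact Or.inl ⟨hy ▸ hx, hy ▸ hx⟩
      · exact Or.inr ⟨hy, trivial⟩
  refine ⟨N, fun n hn w a ha hax b hb => ?_⟩
  rcases hN n hn w a ha b hb with h | h
  · exact h.2
  · exact absurd hax h.1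

/-! ### Iterates of the Hutchinson operator and the crisp attractor. -/

variable [NeZero k]

theorem mem_hutchinson {S : IFS X k} {K : NonemptyCompacts X} {x : X} :
    x ∈ S.hutchinson K ↔ ∃ i, ∃ y ∈ K, S i y = x :=
  mem_iUnion

theorem hutchinson_mono (S : IFS X k) : Monotone S.hutchinson := by
  intro K L hKL x hx
  obtain ⟨i, y, hy, rfl⟩ := mem_hutchinson.1 hx
  exact mem_hutchinson.2 ⟨i, y, hKL hy, rfl⟩

theorem mem_hutchinson_iterate {S : IFS X k} {K : NonemptyCompacts X} {n : ℕ} {x : X} :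
    x ∈ S.hutchinson^[n] K ↔ ∃ w, ∃ a ∈ K, S.comp w n a = x := by
  induction n generalizing x with
  | zero => exact ⟨fun h => ⟨fun _ => 0, x, h, rfl⟩, fun ⟨_, a, ha, h⟩ => h ▸ ha⟩
  | succ n ih =>
    rw [Function.iterate_succ_apply', mem_hutchinson]
    constructor
    · rintro ⟨i, y, hy, rfl⟩
      obtain ⟨w, a, ha, rfl⟩ := ih.1 hy
      -- The new address is `w` with the letter `i` prepended.
      refine ⟨fun m => Nat.casesOn m i w, a, ha, ?_⟩
      rw [comp_succ']
      rfl
    · rintro ⟨w, a, ha, rfl⟩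
      rw [comp_succ']
      exact ⟨w 0, _, ih.2 ⟨_, a, ha, rfl⟩, rfl⟩

theorem hutchinson_iterate_antitone {S : IFS X k} {D : NonemptyCompacts X}
    (hD : S.hutchinson D ≤ D) : Antitone fun n => S.hutchinson^[n] D :=
  S.hutchinson_mono.antitone_iterate_of_map_le hD

/-- On the part of the space dominated by a subinvariant compact set with singleton fibres, all
iterations of the Hutchinson operator converge to one invariant set. -/
theorem exists_invariant_tendsto [T2Space X] {S : IFS X k} {D : NonemptyCompacts X}
    (hD : S.hutchinson D ≤ D)
    (hfib : ∀ w, (⋂ n : ℕ, S.comp w (n + 1) '' (D : Set X)).Subsingleton) :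
    ∃ A : NonemptyCompacts X, S.hutchinson A = A ∧
      ∀ K ≤ D, Tendsto (fun n : ℕ => S.hutchinson^[n] K) atTop (𝓝 A) := by
  set B : ℕ → Set X := fun n => (S.hutchinson^[n] D : NonemptyCompacts X)
  have hBc : ∀ n, IsCompact (B n) := fun n => (S.hutchinson^[n] D).isCompact
  have hBa : Antitone B := fun m n h => hutchinson_iterate_antitone hD h
  have hne : (⋂ n, B n).Nonempty :=
    IsCompact.nonempty_iInter_of_sequence_nonempty_isCompact_isClosed B
      (fun n => hBa n.le_succ) (fun n => (S.hutchinson^[n] D).nonempty) (hBc 0)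
      fun n => (hBc n).isClosed
  let A : NonemptyCompacts X :=
    ⟨⟨⋂ n, B n, (hBc 0).of_isClosed_subset
      (isClosed_iInter fun n => (hBc n).isClosed) (iInter_subset _ 0)⟩, hne⟩
  have hA : ∀ x, x ∈ A ↔ ∀ n, x ∈ S.hutchinson^[n] D := fun x => mem_iInter
  have hmap := mapsTo_of_le hD
  -- A point of `A` in `U` lies in cylinders of every order; a late one is contained in `U`, and
  -- each cylinder meets the iterate of `K`.
  have hlow : ∀ K ≤ D, ∀ U : Set X, IsOpen U → ((A : Set X) ∩ U).Nonempty →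
      ∀ᶠ n in atTop, (((S.hutchinson^[n] K : NonemptyCompacts X) : Set X) ∩ U).Nonempty := by
    rintro K hK U hU ⟨x, hxA, hxU⟩
    obtain ⟨N, hN⟩ := eventually_comp_mem_of_mem D.isCompact hmap hfib hU hxU
    filter_upwards [eventually_ge_atTop N] with n hn
    obtain ⟨w, a, ha, hax⟩ := mem_hutchinson_iterate.1 ((hA x).1 hxA n)
    obtain ⟨b, hb⟩ := K.nonempty
    exact ⟨_, mem_hutchinson_iterate.2 ⟨w, b, hb, rfl⟩, hN n hn w a ha hax b (hK hb)⟩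
  have hsub : S.hutchinson A ≤ A := by
    intro x hx
    obtain ⟨i, y, hy, rfl⟩ := mem_hutchinson.1 hx
    refine (hA _).2 fun n => ?_
    have h1 : S i y ∈ S.hutchinson^[n + 1] D := by
      rw [Function.iterate_succ_apply']
      exact mem_hutchinson.2 ⟨i, y, (hA y).1 hy n, rfl⟩
    exact hBa n.le_succ h1
  have hAD : A ≤ D := fun x hx => (hA x).1 hx 0
  refine ⟨A, le_antisymm hsub fun x hx => by_contra fun hx' => ?_, fun K hK => ?_⟩
  -- If `A` had a point outside `S(A)`, late iterates of `A` would leave `S(A)`, but all iterates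
  -- with `n ≥ 1` stay inside it.
  · obtain ⟨n, hn, hn1⟩ := ((hlow A hAD _ (S.hutchinson A).isCompact.isClosed.isOpen_compl
      ⟨x, hx, hx'⟩).and (eventually_ge_atTop 1)).exists
    obtain ⟨y, hy, hy'⟩ := hn
    exact hy' (hutchinson_iterate_antitone hsub hn1 hy)
  · let := TopologicalSpace.vietoris X
    rw [NonemptyCompacts.isEmbedding_coe.isInducing.tendsto_nhds_iff]
    refine tendsto_nhds_generateFrom_iff.2 ?_
    -- The two subbasic Vietoris conditions: containment in `U` follows from compactness of the
    -- nested `B n`, hitting `U` from `hlow`.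
    rintro _ (⟨U, hU, rfl⟩ | ⟨U, hU, rfl⟩) hAU
    · obtain ⟨N, hN⟩ := exists_subset_nhds_of_isCompact' (V := B)
        hBa.directed_ge hBc (fun n => (hBc n).isClosed) (U := U)
        fun x hx => IsOpen.mem_nhds hU (hAU hx)
      filter_upwards [eventually_ge_atTop N] with n hn
      exact fun x hx => hN (hBa hn (S.hutchinson_mono.iterate n hK hx))
    · exact hlow K hK U hU hAU

theorem IsAttractor.unique [T2Space X] {S : IFS X k} {A B : NonemptyCompacts X}
    (hA : S.IsAttractor A) (hB : S.IsAttractor B) : A = B := by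
  refine tendsto_nhds_unique (f := fun n : ℕ => S.hutchinson^[n] A) ?_ (hB.tendsto A)
  simp only [Function.iterate_fixed hA.invariant]
  exact tendsto_const_nhds

theorem TopologicallyContracting.subsingleton {S : IFS X k} (hS : S.TopologicallyContracting)
    {D : NonemptyCompacts X} (hD : S.hutchinson D ≤ D) (w : ℕ → Fin k) :
    (⋂ n : ℕ, S.comp w (n + 1) '' (D : Set X)).Subsingleton := by
  obtain ⟨x, hx⟩ := hS.2 D hD w
  rw [hx]
  exact subsingleton_singleton

theorem TopologicallyContracting.exists_isAttractor [T2Space X] {S : IFS X k}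
    (hS : S.TopologicallyContracting) [Nonempty X] : ∃ A, S.IsAttractor A := by
  obtain ⟨D, -, hD⟩ := hS.1 (Classical.arbitrary (NonemptyCompacts X))
  obtain ⟨A, hA, hconv⟩ := exists_invariant_tendsto hD (hS.subsingleton hD)
  refine ⟨A, hA, fun K => ?_⟩
  -- A common subinvariant set for `K` and `D` makes the limits agree, since the iterates of `D`
  -- converge to both.
  obtain ⟨D', hKD', hD'⟩ := hS.1 (K ⊔ D)
  obtain ⟨A', -, hconv'⟩ := exists_invariant_tendsto hD' (hS.subsingleton hD')
  rw [tendsto_nhds_unique (hconv D le_rfl) (hconv' D (le_sup_right.trans hKD'))]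
  exact hconv' K (le_sup_left.trans hKD')

/-! ### Restriction to subinvariant compact sets. -/

theorem coe_comp_restrict {S : IFS X k} {K : NonemptyCompacts X} (hK : S.hutchinson K ≤ K)
    (w : ℕ → Fin k) (n : ℕ) (x : K) :
    (((S.restrict K hK).comp w n x : K) : X) = S.comp w n x := by
  induction n generalizing x with
  | zero => rfl
  | succ n ih => exact ih _

theorem subsingleton_restrict {S : IFS X k} {K : NonemptyCompacts X} (hK : S.hutchinson K ≤ K)
    {w : ℕ → Fin k} (h : (⋂ n : ℕ, S.comp w (n + 1) '' (K : Set X)).Subsingleton) :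
    (⋂ n : ℕ, (S.restrict K hK).comp w (n + 1) '' univ).Subsingleton := by
  have key : ∀ x ∈ ⋂ n : ℕ, (S.restrict K hK).comp w (n + 1) '' univ,
      (x : X) ∈ ⋂ n : ℕ, S.comp w (n + 1) '' (K : Set X) := by
    intro x hx
    refine mem_iInter.2 fun n => ?_
    obtain ⟨a, -, rfl⟩ := mem_iInter.1 hx n
    exact ⟨a, a.2, (coe_comp_restrict hK w (n + 1) a).symm⟩
  exact fun x hx y hy => Subtype.ext (h (key x hx) (key y hy))

end IFS

/-! ### Edelstein contractions -/

theorem IsAdmissibleMultimetric.isOpen_ball {X : Type*} [TopologicalSpace X]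
    {D : Set (PseudoMetric X ℝ)} (hD : IsAdmissibleMultimetric D) {d : PseudoMetric X ℝ}
    (hd : d ∈ D) (x : X) (r : ℝ) : IsOpen {y | d x y < r} := by
  have h : IsOpen[distTopology ((fun d : PseudoMetric X ℝ => (d : X → X → ℝ)) '' D)]
      {y | d x y < r} := by
    intro y hy
    have hy' : d x y < r := hy
    refine ⟨r - d x y, sub_pos.2 hy', {(d : X → X → ℝ)}, ?_, fun z hz => ?_⟩
    · rw [Finset.coe_singleton, singleton_subset_iff]
      exact ⟨d, hd, rfl⟩
    · have h1 := hz d (Finset.mem_singleton_self _)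
      have h2 := d.triangle x y z
      change d x z < r
      linarith
  rwa [← hD.generates] at h

theorem IsAdmissibleMultimetric.continuous {X : Type*} [TopologicalSpace X]
    {D : Set (PseudoMetric X ℝ)} (hD : IsAdmissibleMultimetric D) {d : PseudoMetric X ℝ}
    (hd : d ∈ D) : Continuous fun p : X × X => d p.1 p.2 := by
  refine continuous_iff_continuousAt.2 fun ⟨x, y⟩ => Metric.tendsto_nhds.2 fun ε hε => ?_
  have hball : ∀ z, ∀ᶠ z' in 𝓝 z, d z z' < ε / 2 := fun z =>
    (hD.isOpen_ball hd z (ε / 2)).mem_nhds (by simpa using hε)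
  filter_upwards [(hball x).prod_nhds (hball y)] with p hp
  have h1 := d.triangle p.1 x p.2
  have h2 := d.triangle x y p.2
  have h3 := d.triangle x p.1 y
  have h4 := d.triangle p.1 p.2 y
  rw [d.symm p.1 x] at h1
  rw [d.symm p.2 y] at h4
  rw [Real.dist_eq, abs_lt]
  constructor <;> linarith [hp.1, hp.2]

namespace IFS

variable {X : Type*} [TopologicalSpace X] [T2Space X] {k : ℕ}

/-- A point in the fibre of an address is the image of a point in the fibre of the shifted
address. -/
theorem exists_mem_fibre_shift {S : IFS X k} {D : Set X} (hD : IsCompact D)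
    (hmap : ∀ i, MapsTo (S i) D D) {w : ℕ → Fin k} {x : X} (hx : x ∈ ⋂ n, S.comp w n '' D) :
    ∃ y ∈ ⋂ n, S.comp (fun m => w (m + 1)) n '' D, S (w 0) y = x := by
  have hc : ∀ n, IsCompact (S.comp (fun m => w (m + 1)) n '' D) := fun n =>
    hD.image (S.continuous_comp _ n)
  have hcl : IsClosed (S (w 0) ⁻¹' {x}) := isClosed_singleton.preimage (S (w 0)).continuous
  -- Each order supplies a preimage of `x` in the shifted cylinder; compactness gives one that
  -- serves all orders.
  obtain ⟨y, hy⟩ := IsCompact.nonempty_iInter_of_sequence_nonempty_isCompact_isClosed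
    (fun n => S.comp (fun m => w (m + 1)) n '' D ∩ S (w 0) ⁻¹' {x})
    (fun n => inter_subset_inter_left _ (comp_succ_image_subset hmap _ n))
    (fun n => by
      obtain ⟨a, ha, hax⟩ := mem_iInter.1 hx (n + 1)
      rw [comp_succ'] at hax
      exact ⟨_, ⟨a, ha, rfl⟩, hax⟩)
    ((hc 0).inter_right hcl) fun n => (hc n).isClosed.inter hcl
  rw [mem_iInter] at hy
  exact ⟨y, mem_iInter.2 fun n => (hy n).1, (hy 0).2⟩

/-- Among all pairs in a common fibre, over all addresses, some pair maximizes `d`. It is the image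
of a pair in the fibre of the shifted address, so a positive maximum would be strictly below the
distance of that earlier pair. -/
theorem EdelsteinContracting.dist_eq_zero {S : IFS X k} {M : Set (PseudoMetric X ℝ)}
    (hM : IsAdmissibleMultimetric M) (hS : S.EdelsteinContracting M) {D : Set X}
    (hD : IsCompact D) (hmap : ∀ i, MapsTo (S i) D D) {d : PseudoMetric X ℝ} (hd : d ∈ M)
    {w : ℕ → Fin k} {x y : X} (hx : x ∈ ⋂ n, S.comp w n '' D) (hy : y ∈ ⋂ n, S.comp w n '' D) :
    d x y ≤ 0 := by
  set Q : Set ((ℕ → Fin k) × X × X) := ⋂ n, S.cylinderPairs D n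
  have hmem : ∀ {w x y}, x ∈ ⋂ n, S.comp w n '' D → y ∈ ⋂ n, S.comp w n '' D → (w, x, y) ∈ Q :=
    fun hx hy => mem_iInter.2 fun n => ⟨mem_iInter.1 hx n, mem_iInter.1 hy n⟩
  have hQc : IsCompact Q := (S.isCompact_cylinderPairs hD 0).of_isClosed_subset
    (isClosed_iInter fun n => (S.isCompact_cylinderPairs hD n).isClosed) (iInter_subset _ 0)
  have hcont : Continuous fun p : (ℕ → Fin k) × X × X => d p.2.1 p.2.2 :=
    (hM.continuous hd).comp continuous_snd
  obtain ⟨⟨w₀, x₀, y₀⟩, hp, hmax⟩ := hQc.exists_isMaxOn ⟨_, hmem hx hy⟩ hcont.continuousOn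
  refine le_trans (hmax (hmem hx hy)) (not_lt.1 fun hpos => ?_)
  have hpos : 0 < d x₀ y₀ := hpos
  obtain ⟨x₁, hx₁, hx₁'⟩ := exists_mem_fibre_shift (w := w₀) (x := x₀) hD hmap
    (mem_iInter.2 fun n => (mem_iInter.1 hp n).1)
  obtain ⟨y₁, hy₁, hy₁'⟩ := exists_mem_fibre_shift (w := w₀) (x := y₀) hD hmap
    (mem_iInter.2 fun n => (mem_iInter.1 hp n).2)
  subst hx₁' hy₁'
  have h1 : d x₁ y₁ ≤ d (S (w₀ 0) x₁) (S (w₀ 0) y₁) := hmax (hmem hx₁ hy₁)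
  have h2 := (hS d hd (w₀ 0)).2 x₁ y₁ (hpos.trans_le ((hS d hd (w₀ 0)).1 x₁ y₁))
  exact absurd h2 (not_lt.2 h1)

theorem EdelsteinContracting.topologicallyContracting [NeZero k] {S : IFS X k}
    {M : Set (PseudoMetric X ℝ)} (hM : IsAdmissibleMultimetric M) (hS : S.EdelsteinContracting M)
    (hdom : S.CompactlyDominating) : S.TopologicallyContracting := by
  refine ⟨hdom, fun D hD w => ?_⟩
  have hmap := mapsTo_of_le hD
  have hc : ∀ n, IsCompact (S.comp w n '' (D : Set X)) := fun n =>
    D.isCompact.image (S.continuous_comp w n)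
  obtain ⟨x, hx⟩ := IsCompact.nonempty_iInter_of_sequence_nonempty_isCompact_isClosed
    (fun n => S.comp w n '' (D : Set X)) (comp_succ_image_subset hmap w)
    (fun n => D.nonempty.image _) (hc 0) fun n => (hc n).isClosed
  refine ⟨x, ?_⟩
  rw [iInter_comp_succ_image hmap]
  refine (Set.Subsingleton.eq_singleton_of_mem (fun a ha b hb => by_contra fun hab => ?_) hx)
  obtain ⟨d, hd, hpos⟩ := hM.separates a b hab
  exact absurd hpos (not_lt.2 (hS.dist_eq_zero hM D.isCompact hmap hd ha hb))

end IFS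

/-! ### Invariant fuzzy sets -/

section Fuzzy

variable {X : Type*} [TopologicalSpace X]

@[ext]
theorem CompactFuzzySet.ext {u v : CompactFuzzySet X} (h : ∀ x, u x = v x) : u = v := by
  cases u
  cases v
  congr
  exact funext h

theorem mem_fuzzyCut_zero_of_pos {u : X → I} {x : X} (h : 0 < u x) : x ∈ fuzzyCut u 0 := by
  rw [fuzzyCut, if_pos rfl]
  exact subset_closure h

variable [T2Space X] {k : ℕ} [NeZero k] {S : IFS X k} {ρ : GreyLevelSystem k}

theorem le_fuzzyHutchinson (v : CompactFuzzySet X) (i : Fin k) (x : X) :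
    ρ i (v x) ≤ fuzzyHutchinson S ρ v (S i x) :=
  le_iSup_of_le i (ρ.monotone' i (le_iSup₂_of_le x rfl le_rfl))

/-- At positive levels both the maximum over `i` and the supremum over the fibre are attained, which
lets a grey value be traced back to a point. -/
theorem exists_le_of_le_fuzzyHutchinson {v : CompactFuzzySet X} {y : X} {α : I} (hα : 0 < α)
    (h : α ≤ fuzzyHutchinson S ρ v y) : ∃ i x, S i x = y ∧ 0 < v x ∧ α ≤ ρ i (v x) := by
  change α ≤ ⨆ i, ρ i (fuzzyImage (S i) v y) at h
  obtain ⟨i, hi⟩ := exists_eq_ciSup_of_finite (f := fun i => ρ i (fuzzyImage (S i) v y))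
  rw [← hi] at h
  have h0 : fuzzyImage (S i) v y ≠ 0 := fun h0 => by
    simp only [h0, ρ.map_zero'] at h
    exact absurd h (not_le.2 hα)
  obtain ⟨x, hx, hux⟩ := exists_eq_fuzzyImage (S i) v y h0
  refine ⟨i, x, hx, ?_, by rw [hux]; exact h⟩
  rw [hux]
  exact lt_of_le_of_ne unitInterval.nonneg' h0.symm

/-- A value of an iterate at a point `y` comes from a cylinder containing `y`, and is attained by the
iterates of every other compact fuzzy set in the same cylinder. -/
theorem exists_comp_of_le_iterate (n : ℕ) {v : CompactFuzzySet X} {y : X} {α : I} (hα : 0 < α)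
    (h : α ≤ (fuzzyHutchinson S ρ)^[n] v y) :
    ∃ w a, S.comp w n a = y ∧ 0 < v a ∧
      ∀ (v' : CompactFuzzySet X) (b : X), v' b = 1 →
        α ≤ (fuzzyHutchinson S ρ)^[n] v' (S.comp w n b) := by
  induction n generalizing y α with
  | zero =>
    refine ⟨fun _ => 0, y, rfl, hα.trans_le h, fun v' b hb => ?_⟩
    change α ≤ v' b
    rw [hb]
    exact unitInterval.le_one'
  | succ n ih =>
    rw [Function.iterate_succ_apply'] at h
    obtain ⟨i, x, rfl, hpos, hle⟩ := exists_le_of_le_fuzzyHutchinson hα h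
    -- The induction runs at the full value of the previous iterate at `x`, not at `α`; monotonicity
    -- of `ρ i` then recovers `α`.
    obtain ⟨w, a, rfl, ha, hv'⟩ := ih hpos le_rfl
    refine ⟨fun m => Nat.casesOn m i w, a, by rw [IFS.comp_succ']; rfl, ha, fun v' b hb => ?_⟩
    rw [Function.iterate_succ_apply', IFS.comp_succ']
    exact (hle.trans (ρ.monotone' i (hv' v' b hb))).trans (le_fuzzyHutchinson _ i _)

/-- If `u x > 0`, invariance places `x` in cylinders of every order over a subinvariant `D`
containing `K` and the support of `u`. A late one misses `K`, although the same composition maps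
points of `K` into `K`. -/
theorem eq_zero_of_notMem {u : CompactFuzzySet X} (hu : u = fuzzyHutchinson S ρ u)
    (hS : S.TopologicallyContracting) {K : NonemptyCompacts X} (hK : S.hutchinson K ≤ K) {x : X}
    (hx : x ∉ K) : u x = 0 := by
  by_contra h0
  have hpos : 0 < u x := lt_of_le_of_ne unitInterval.nonneg' (Ne.symm h0)
  let L : NonemptyCompacts X :=
    ⟨⟨fuzzyCut u 0, u.isCompact_support'⟩, x, mem_fuzzyCut_zero_of_pos hpos⟩
  obtain ⟨D, hLD, hD⟩ := hS.1 (K ⊔ L)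
  obtain ⟨N, hN⟩ := IFS.eventually_comp_mem_of_mem D.isCompact (IFS.mapsTo_of_le hD)
    (hS.subsingleton hD) K.isCompact.isClosed.isOpen_compl hx
  have hiter : (fuzzyHutchinson S ρ)^[N] u = u := Function.iterate_fixed hu.symm N
  obtain ⟨w, a, hax, ha, -⟩ := exists_comp_of_le_iterate (S := S) (ρ := ρ) (v := u) N hpos
    (by rw [hiter])
  obtain ⟨b, hb⟩ := K.nonempty
  exact hN N le_rfl w a (hLD (le_sup_right (a := K) (mem_fuzzyCut_zero_of_pos ha))) hax b
    (hLD (le_sup_left (b := L) hb)) (IFS.comp_mapsTo (IFS.mapsTo_of_le hK) w N hb)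

/-- The restriction of an invariant fuzzy set to a subinvariant compact set. -/
theorem exists_restrict_invariant {u : CompactFuzzySet X} (hu : u = fuzzyHutchinson S ρ u)
    (hS : S.TopologicallyContracting) {K : NonemptyCompacts X} (hK : S.hutchinson K ≤ K) :
    ∃ v : CompactFuzzySet K, (∀ x : K, v x = u x) ∧
      v = fuzzyHutchinson (S.restrict K hK) ρ v := by
  have h0 : ∀ x, x ∉ K → u x = 0 := fun x hx => eq_zero_of_notMem hu hS hK hx
  let v : CompactFuzzySet K :=
    { toFun := fun x => u x
      normal' := by
        obtain ⟨x, hx⟩ := u.normal'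
        have hxK : x ∈ K := by_contra fun h => zero_ne_one ((h0 x h).symm.trans hx)
        exact ⟨⟨x, hxK⟩, hx⟩
      usc' := u.usc'.comp continuous_subtype_val
      isCompact_support' := by
        have : CompactSpace K := isCompact_iff_compactSpace.1 K.isCompact
        rw [fuzzyCut, if_pos rfl]
        exact isClosed_closure.isCompact }
  refine ⟨v, fun _ => rfl, CompactFuzzySet.ext fun x => ?_⟩
  have himg : ∀ i, fuzzyImage (S i) u (x : X) = fuzzyImage (S.restrict K hK i) v x := by
    intro i
    refine le_antisymm (iSup₂_le fun y hy => ?_) (iSup₂_le fun y hy => ?_)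
    · by_cases hyK : y ∈ K
      · exact le_iSup₂_of_le (f := fun (z : K) (_ : z ∈ S.restrict K hK i ⁻¹' {x}) => v z)
          ⟨y, hyK⟩ (Subtype.ext hy) le_rfl
      -- Fibre points outside `K` contribute `0`, so passing to `K` does not change the supremum.
      · rw [h0 y hyK]
        exact unitInterval.nonneg'
    · exact le_iSup₂_of_le (f := fun (z : X) (_ : z ∈ S i ⁻¹' {(x : X)}) => u z)
        (y : X) (congrArg Subtype.val hy) le_rfl
  have hux : u x = fuzzyHutchinson S ρ u x := congrArg (fun z : CompactFuzzySet X => z x) hu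
  calc v x = u x := rfl
    _ = ⨆ i, ρ i (fuzzyImage (S i) u (x : X)) := hux
    _ = ⨆ i, ρ i (fuzzyImage (S.restrict K hK i) v x) := by simp only [himg]

end Fuzzy

/-- One half of an estimate for the fuzzy Hausdorff distance. -/
theorem iSup_fuzzyCut_le {Y : Type*} [TopologicalSpace Y]
    {d : PseudoMetric Y ℝ} {ε : ℝ} {v v' : CompactFuzzySet Y}
    (h : ∀ x (α : I), 0 < α → α ≤ v x → ∃ y, α ≤ v' y ∧ d x y < ε)
    (hd : Continuous fun p : Y × Y => d p.1 p.2) (hε : 0 < ε) (α : I) :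
    ⨆ x ∈ fuzzyCut v α, ⨅ y ∈ fuzzyCut v' α, ENNReal.ofReal (d x y) ≤ ENNReal.ofReal (2 * ε) := by
  refine iSup₂_le fun x hx => ?_
  suffices ∃ y ∈ fuzzyCut v' α, d x y ≤ 2 * ε by
    obtain ⟨y, hy, hxy⟩ := this
    exact iInf₂_le_of_le y hy (ENNReal.ofReal_le_ofReal hxy)
  by_cases hα : α = 0
  · subst hα
    -- The support is a closure: one `ε` moves `x` to a point of positive value, the other applies
    -- `h` there, hence the factor `2`.
    rw [fuzzyCut, if_pos rfl] at hx
    have hc : Continuous fun y => d x y :=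
      hd.comp (continuous_const.prodMk continuous_id : Continuous fun y : Y => (x, y))
    obtain ⟨x', hx', hpos⟩ := mem_closure_iff.1 hx {y | d x y < ε}
      (isOpen_lt hc continuous_const) (by simpa using hε)
    obtain ⟨y, hy, hdy⟩ := h x' (v x') hpos le_rfl
    refine ⟨y, mem_fuzzyCut_zero_of_pos (lt_of_lt_of_le hpos hy), ?_⟩
    have h1 : d x x' < ε := hx'
    linarith [d.triangle x x' y]
  · rw [fuzzyCut, if_neg hα] at hx
    obtain ⟨y, hy, hdy⟩ := h x α (lt_of_le_of_ne unitInterval.nonneg' (Ne.symm hα)) hx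
    refine ⟨y, ?_, by linarith⟩
    rw [fuzzyCut, if_neg hα]
    exact hy

/-! ### Fuzzy attractors on compact spaces -/

section Compact

variable {Y : Type*} [TopologicalSpace Y] [CompactSpace Y] [T2Space Y] {k : ℕ} [NeZero k]
  {T : IFS Y k} {ρ : GreyLevelSystem k}

/-- Were `v' x < v x`, upper semicontinuity would make `{v' < v x}` an open neighbourhood of `x`,
containing every late cylinder through `x`. Transfer finds a point in such a cylinder where `v'` is
at least `v x`. -/
theorem le_of_invariant (hfib : ∀ w, (⋂ n : ℕ, T.comp w (n + 1) '' univ).Subsingleton)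
    {v v' : CompactFuzzySet Y} (hv : v = fuzzyHutchinson T ρ v)
    (hv' : v' = fuzzyHutchinson T ρ v') (x : Y) : v x ≤ v' x := by
  by_contra hlt
  rw [not_le] at hlt
  obtain ⟨N, hN⟩ := IFS.eventually_comp_mem_of_mem isCompact_univ (fun i => mapsTo_univ _ _) hfib
    (v'.usc'.isOpen_preimage (v x)) (x := x) hlt
  obtain ⟨b, hb⟩ := v'.normal'
  obtain ⟨w, a, hax, -, h⟩ := exists_comp_of_le_iterate (S := T) (ρ := ρ) (v := v) (α := v x) N
    (unitInterval.nonneg'.trans_lt hlt) (by rw [Function.iterate_fixed hv.symm N])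
  have h1 := h v' b hb
  rw [Function.iterate_fixed hv'.symm N] at h1
  exact absurd (hN N le_rfl w a trivial hax b trivial) (not_lt.2 h1)

theorem eq_of_invariant (hfib : ∀ w, (⋂ n : ℕ, T.comp w (n + 1) '' univ).Subsingleton)
    {v v' : CompactFuzzySet Y} (hv : v = fuzzyHutchinson T ρ v)
    (hv' : v' = fuzzyHutchinson T ρ v') : v = v' :=
  CompactFuzzySet.ext fun x =>
    le_antisymm (le_of_invariant hfib hv hv' x) (le_of_invariant hfib hv' hv x)

/-- The iterations of any two compact fuzzy sets approach each other uniformly. -/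
theorem fuzzyHausdorffDist_iterate_le
    (hfib : ∀ w, (⋂ n : ℕ, T.comp w (n + 1) '' univ).Subsingleton)
    {d : PseudoMetric Y ℝ} (hd : Continuous fun p : Y × Y => d p.1 p.2) {ε : ℝ} (hε : 0 < ε) :
    ∃ N, ∀ n ≥ N, ∀ v v' : CompactFuzzySet Y,
      fuzzyHausdorffDist d ((fuzzyHutchinson T ρ)^[n] v) ((fuzzyHutchinson T ρ)^[n] v') ≤
        ENNReal.ofReal (2 * ε) := by
  obtain ⟨N, hN⟩ := IFS.eventually_comp_mem isCompact_univ (fun i => mapsTo_univ _ _) hfib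
    (W := {p : Y × Y | d p.1 p.2 < ε}) (isOpen_lt hd continuous_const) fun x => by simpa using hε
  have key : ∀ n ≥ N, ∀ v v' : CompactFuzzySet Y, ∀ x (α : I), 0 < α →
      α ≤ (fuzzyHutchinson T ρ)^[n] v x →
        ∃ y, α ≤ (fuzzyHutchinson T ρ)^[n] v' y ∧ d x y < ε := by
    intro n hn v v' x α hα hx
    obtain ⟨w, a, rfl, -, h⟩ := exists_comp_of_le_iterate n hα hx
    obtain ⟨b, hb⟩ := v'.normal'
    exact ⟨_, h v' b hb, hN n hn w a trivial b trivial⟩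
  refine ⟨N, fun n hn v v' => iSup_le fun α => max_le ?_ ?_⟩
  · exact iSup_fuzzyCut_le (key n hn v v') hd hε α
  · simpa only [d.symm] using iSup_fuzzyCut_le (key n hn v' v) hd hε α

theorem isFuzzyAttractor_of_invariant
    (hfib : ∀ w, (⋂ n : ℕ, T.comp w (n + 1) '' univ).Subsingleton)
    {v : CompactFuzzySet Y} (hv : v = fuzzyHutchinson T ρ v) : IsFuzzyAttractor T ρ v := by
  refine ⟨hv, fun v' => ?_⟩
  let := mTopology Y
  refine tendsto_nhds.2 fun U hU hvU => ?_
  obtain ⟨ε, hε, G, hG, hGU⟩ := hU v hvU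
  -- The radius `ε` may be infinite, so a finite positive `r` below it is used; halving `r` later
  -- absorbs the factor `2`.
  obtain ⟨r, hr, hrε⟩ := ENNReal.lt_iff_exists_nnreal_btwn.1 hε
  have hr0 : (0 : ℝ) < r := by exact_mod_cast hr
  have hev : ∀ᶠ n in atTop, ∀ d ∈ G, d v ((fuzzyHutchinson T ρ)^[n] v') < ε := by
    refine (Filter.eventually_all_finset G).2 fun d hd => ?_
    obtain ⟨d, hd', rfl⟩ := hG hd
    -- Finite maxima of continuous pseudometrics are continuous, so the uniform estimate applies to
    -- `d` directly.
    rw [continuousPseudoMetrics_directed] at hd'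
    obtain ⟨N, hN⟩ := fuzzyHausdorffDist_iterate_le (ρ := ρ) hfib hd' (half_pos hr0)
    filter_upwards [eventually_ge_atTop N] with n hn
    have h1 := hN n hn v v'
    rw [Function.iterate_fixed hv.symm n, mul_div_cancel₀ _ two_ne_zero,
      ENNReal.ofReal_coe_nnreal] at h1
    exact h1.trans_lt hrε
  exact hev.mono fun n hn => hGU hn

end Compact

/-! ### Assembly of the proposition. -/

theorem proposition4p4 {X : Type*} [TopologicalSpace X] [T2Space X] {k : ℕ} [NeZero k]
    (S : IFS X k) (ρ : GreyLevelSystem k) (u : CompactFuzzySet X)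
    (hu : (S.TopologicallyContracting ∧ IsWeakFuzzyAttractor S ρ u) ∨
      ∃ D : Set (PseudoMetric X ℝ), IsAdmissibleMultimetric D ∧ S.CompactlyDominating ∧
        S.EdelsteinContracting D ∧ IsMultimetricFuzzyAttractor D S ρ u) :
    ((∃! A : NonemptyCompacts X, S.IsAttractor A) ∧
      ∀ (A : NonemptyCompacts X) (hA : S.IsAttractor A),
        (∃! v : CompactFuzzySet A, IsFuzzyAttractor (S.restrict A hA.invariant.le) ρ v) ∧
          ∀ v : CompactFuzzySet A, IsFuzzyAttractor (S.restrict A hA.invariant.le) ρ v →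
            u.toFun = zeroExtension (Y := (A : Set X)) v) ∧
      ∀ (K : NonemptyCompacts X) (hK : S.hutchinson K ≤ K),
        ∃ v : CompactFuzzySet K, (∀ x : K, v x = u x) ∧
          IsFuzzyAttractor (S.restrict K hK) ρ v := by
  -- Both alternatives are reduced to topological contractivity and invariance of `u`.
  have hS : S.TopologicallyContracting := by
    rcases hu with ⟨h, -⟩ | ⟨D, hD, hdom, hE, -⟩
    · exact h
    · exact hE.topologicallyContracting hD hdom
  have hinv : u = fuzzyHutchinson S ρ u := by
    rcases hu with ⟨-, h⟩ | ⟨D, -, -, -, h⟩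
    · exact h.invariant
    · exact h.invariant
  have hfib : ∀ (K : NonemptyCompacts X) (hK : S.hutchinson K ≤ K) (w : ℕ → Fin k),
      (⋂ n : ℕ, (S.restrict K hK).comp w (n + 1) '' univ).Subsingleton := fun K hK w =>
    IFS.subsingleton_restrict hK (hS.subsingleton hK w)
  have hrestrict : ∀ (K : NonemptyCompacts X) (hK : S.hutchinson K ≤ K),
      ∃ v : CompactFuzzySet K, (∀ x : K, v x = u x) ∧
        IsFuzzyAttractor (S.restrict K hK) ρ v := by
    intro K hK
    obtain ⟨v, hvu, hv⟩ := exists_restrict_invariant hinv hS hK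
    have : CompactSpace K := isCompact_iff_compactSpace.1 K.isCompact
    exact ⟨v, hvu, isFuzzyAttractor_of_invariant (hfib K hK) hv⟩
  have : Nonempty X := u.normal'.nonempty
  obtain ⟨A₀, hA₀⟩ := hS.exists_isAttractor
  refine ⟨⟨⟨A₀, hA₀, fun B hB => hB.unique hA₀⟩, fun A hA => ?_⟩, hrestrict⟩
  have : CompactSpace A := isCompact_iff_compactSpace.1 A.isCompact
  obtain ⟨v, hvu, hv⟩ := hrestrict A hA.invariant.le
  have huniq : ∀ v' : CompactFuzzySet A, IsFuzzyAttractor (S.restrict A hA.invariant.le) ρ v' →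
      v' = v := fun v' hv' => eq_of_invariant (hfib A _) hv'.invariant hv.invariant
  refine ⟨⟨v, hv, huniq⟩, fun v' hv' => ?_⟩
  rw [huniq v' hv']
  funext x
  by_cases hx : x ∈ (A : Set X)
  · rw [zeroExtension, dif_pos hx]
    exact (hvu ⟨x, hx⟩).symm
  · rw [zeroExtension, dif_neg hx]
    exact eq_zero_of_notMem hinv hS hA.invariant.le hx
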